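/- Let $T$ be the rooted binary tree, whose vertices are the finite words over a two-letter alphabet. For $g\in\operatorname{Aut}T$ and a vertex $u$, the section $g_u\in\operatorname{Aut}T$ is defined by $g(uw)=g(u)\,g_u(w)$ for all words $w$; write $g=(g_1,g_2)\alpha$, where $g_1,g_2$ are the sections of $g$ at the two vertices of level 1 and $\alpha\in S_2$ is the action of $g$ on level 1. The first Grigorchuk group $\Gamma\leq\operatorname{Aut}T$ is generated by the automorphism $a$ exchanging the two subtrees on level 1 (so $a=(1,1)(1\,2)$) and by $b,c,d$, which fix level 1 and are defined recursively by $b=(a,c)$, $c=(a,d)$, $d=(1,b)$. The nucleus $\mathcal N$ of $\Gamma$ is the smallest finite set $\mathcal M\subseteq\Gamma$ such that for every $g\in\Gamma$ there is a level $n$ for which all sections of $g$ at vertices at and below level $n$ belong to $\mathcal M$. The portrait of $g\in\Gamma$ is the finite decorated tree constructed recursively as follows: if $g\in\mathcal N$, it is a single vertex decorated by $g$; otherwise its root is decorated by $\alpha$ and the portraits of $g_1,g_2$ are attached at the two vertices of level 1. Let $a_n$ be the number of elements of $\Gamma$ whose portrait has depth at most $n$, where the depth is the length of a longest path from the root to a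 leaf. The sequence $(a_n)_{n\geq 0}$ is the portrait growth sequence of $\Gamma$. **Theorem.** There is a constant $\gamma>0$, with $\gamma\approx 0.71$ (correctly rounded to two decimals, that is, $|\gamma-0.71|<0.005$), such that for all $n\geq 0$ $$\tfrac14\,e^{\gamma 2^n}\;\leq\; a_n\;\leq\; 4\,e^{\gamma 2^n}.$$ -/

import Mathlib

namespace PortraitGrowth

/-! ## The regular rooted tree and its automorphisms -/

/-- The regular rooted tree over the alphabet `X`: its vertices are the words over `X`, and
two words are joined by an edge when one of them extends the other by one letter on the right.
The root is the empty word. -/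
def tree (X : Type*) : SimpleGraph (List X) where
  Adj u v := ∃ x : X, v = u ++ [x] ∨ u = v ++ [x]
  symm := ⟨by rintro u v ⟨x, h | h⟩ <;> exact ⟨x, by tauto⟩⟩
  loopless := ⟨by rintro u ⟨x, h | h⟩ <;> simpa using congrArg List.length h⟩

/-- The automorphism group `Aut T` of the regular rooted tree: permutations of the vertices that
preserve incidence and the root. -/
def treeAut (X : Type*) : Subgroup (Equiv.Perm (List X)) where
  carrier := {g | g [] = [] ∧ ∀ u v, (tree X).Adj (g u) (g v) ↔ (tree X).Adj u v}
  one_mem' := by simp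
  mul_mem' := by
    rintro g h ⟨hg, hg'⟩ ⟨hh, hh'⟩
    exact ⟨by simp [hg, hh], fun u v => by simp [hg', hh']⟩
  inv_mem' := by
    rintro g ⟨hg, hg'⟩
    refine ⟨by rw [Equiv.Perm.inv_eq_iff_eq, hg], fun u v => ?_⟩
    rw [← hg' (g⁻¹ u) (g⁻¹ v)]
    simp

/-- The type of automorphisms of the regular rooted tree over `X`. -/
abbrev TreeAut (X : Type*) := ↥(treeAut X)

variable {X : Type*}

/-- An automorphism sends children of `u` to children of the image of `u`. -/
theorem exists_apply_child (g : TreeAut X) (u : List X) (x : X) :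
    ∃ y, g.1 (u ++ [x]) = g.1 u ++ [y] := by
  obtain ⟨g, h0, hadj⟩ := g
  simp only
  induction u using List.reverseRecOn generalizing x with
  | nil =>
    obtain ⟨y, h | h⟩ := (hadj [] ([] ++ [x])).2 ⟨x, Or.inl rfl⟩
    · exact ⟨y, h⟩
    · rw [h0] at h
      simp at h
  | append_singleton u z ih =>
    obtain ⟨y, h | h⟩ := (hadj (u ++ [z]) (u ++ [z] ++ [x])).2 ⟨x, Or.inl rfl⟩
    · exact ⟨y, h⟩
    · obtain ⟨w, hw⟩ := ih z
      rw [hw] at h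
      have h1 := g.injective (List.append_inj_left' h rfl)
      simpa using congrArg List.length h1

/-- An automorphism maps the subtree below `u` to the subtree below the image of `u`. -/
theorem exists_apply_append (g : TreeAut X) (u w : List X) :
    ∃ w', g.1 (u ++ w) = g.1 u ++ w' := by
  induction w using List.reverseRecOn with
  | nil => exact ⟨[], by simp⟩
  | append_singleton w x ih =>
    obtain ⟨w', hw'⟩ := ih
    obtain ⟨y, hy⟩ := exists_apply_child g (u ++ w) x
    exact ⟨w' ++ [y], by rw [← List.append_assoc, hy, hw', List.append_assoc]⟩

/-- The underlying map of the section of `g` at the vertex `u`: drop the prefix `g u` from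
the word `g (u w)`. -/
def secFun (g : TreeAut X) (u w : List X) : List X :=
  (g.1 (u ++ w)).drop (g.1 u).length

theorem append_secFun (g : TreeAut X) (u w : List X) :
    g.1 u ++ secFun g u w = g.1 (u ++ w) := by
  obtain ⟨w', hw'⟩ := exists_apply_append g u w
  simp [secFun, hw']

theorem secFun_secFun (g h : TreeAut X) (u v : List X) (hv : g.1 u = v)
    (hgh : ∀ w, h.1 (g.1 w) = w) (w : List X) : secFun h v (secFun g u w) = w := by
  subst hv
  have h1 := append_secFun h (g.1 u) (secFun g u w)
  rw [append_secFun g, hgh, hgh] at h1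
  exact List.append_cancel_left h1

/-- Adjacency is unchanged by adding a common prefix. -/
theorem tree_adj_append (u v w : List X) :
    (tree X).Adj (u ++ v) (u ++ w) ↔ (tree X).Adj v w := by
  simp [tree, List.append_assoc]

/-- The section of `g` at the vertex `u`: the automorphism `g_u` with
`g (u w) = g (u) g_u (w)` for every word `w`. -/
def sectionAt (g : TreeAut X) (u : List X) : TreeAut X :=
  ⟨{ toFun := secFun g u
     invFun := secFun g⁻¹ (g.1 u)
     left_inv := secFun_secFun g g⁻¹ u _ rfl (by simp)
     right_inv := secFun_secFun g⁻¹ g _ u (by simp) (by simp) },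
   by
    refine ⟨?_, fun v w => ?_⟩
    · simp [secFun]
    · change (tree X).Adj (secFun g u v) (secFun g u w) ↔ _
      rw [← tree_adj_append (g.1 u), append_secFun, append_secFun, g.2.2, tree_adj_append]⟩

theorem apply_append (g : TreeAut X) (u w : List X) :
    g.1 (u ++ w) = g.1 u ++ (sectionAt g u).1 w :=
  (append_secFun g u w).symm

/-! ## Nucleus, portraits and portrait growth -/

/-- The family of finite sets `M` of elements of `G` such that, for every `g` in `G`, there is a
level `n` such that all sections of `g` at and below level `n` belong to `M`. The group `G` is
contracting when this family is nonempty. -/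
def contractingSets (G : Subgroup (TreeAut X)) : Set (Set (TreeAut X)) :=
  {M | M.Finite ∧ M ⊆ G ∧
    ∀ g ∈ G, ∃ n : ℕ, ∀ u : List X, n ≤ u.length → sectionAt g u ∈ M}

/-- The nucleus of `G`, the smallest of the sets in `contractingSets G`. -/
def nucleus (G : Subgroup (TreeAut X)) : Set (TreeAut X) :=
  ⋂₀ contractingSets G

/-- For a contracting group, the nucleus is indeed the least member of the family. -/
theorem isLeast_nucleus (G : Subgroup (TreeAut X)) (h : (contractingSets G).Nonempty) :
    IsLeast (contractingSets G) (nucleus G) := by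
  refine ⟨?_, fun M hM => Set.sInter_subset_of_mem hM⟩
  obtain ⟨M, hM, hmin⟩ :=
    exists_minimalFor_of_wellFoundedLT (· ∈ contractingSets G) Set.ncard h
  have key : ∀ M' ∈ contractingSets G, M ⊆ M' := by
    intro M' hM'
    have hI : M ∩ M' ∈ contractingSets G := by
      refine ⟨hM.1.subset Set.inter_subset_left, Set.inter_subset_left.trans hM.2.1,
        fun g hg => ?_⟩
      obtain ⟨n, hn⟩ := hM.2.2 g hg
      obtain ⟨n', hn'⟩ := hM'.2.2 g hg
      exact ⟨max n n', fun u hu =>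
        ⟨hn u ((le_max_left _ _).trans hu), hn' u ((le_max_right _ _).trans hu)⟩⟩
    have hle : M.ncard ≤ (M ∩ M').ncard :=
      hmin hI (Set.ncard_le_ncard Set.inter_subset_left hM.1)
    exact Set.inter_eq_left.1 (Set.eq_of_subset_of_ncard_le Set.inter_subset_left hle hM.1)
  have hN : nucleus G = M :=
    Set.Subset.antisymm (Set.sInter_subset_of_mem hM) (Set.subset_sInter key)
  rw [hN]
  exact hM

/-- Finite trees whose interior vertices are decorated by permutations of `X` and have children
indexed by `X`, and whose leaves are decorated by tree automorphisms. -/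
inductive Portrait (X : Type*) where
  | leaf (g : TreeAut X) : Portrait X
  | node (α : Equiv.Perm X) (child : X → Portrait X) : Portrait X

/-- The length of the largest ray from the root to a leaf. -/
def Portrait.depth [Fintype X] : Portrait X → ℕ
  | .leaf _ => 0
  | .node _ child => 1 + Finset.univ.sup fun x => (child x).depth

/-- `IsPortrait N g P` says that `P` is the portrait of `g` with respect to the set `N`. If
`g ∈ N` the portrait is a single vertex decorated by `g`. Otherwise its root is decorated by the
action `α` of `g` on the first level, and the portraits of the sections of `g` at the vertices of
the first level are attached there. -/
inductive IsPortrait (N : Set (TreeAut X)) : TreeAut X → Portrait X → Prop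
  | leaf (g : TreeAut X) (hg : g ∈ N) : IsPortrait N g (.leaf g)
  | node (g : TreeAut X) (hg : g ∉ N) (α : Equiv.Perm X) (hα : ∀ x, g.1 [x] = [α x])
      (child : X → Portrait X) (hchild : ∀ x, IsPortrait N (sectionAt g [x]) (child x)) :
      IsPortrait N g (.node α child)

/-- The portrait growth sequence of `G`: the number of elements of `G` whose nucleus portrait has
depth at most `n`. -/
noncomputable def portraitGrowth [Fintype X] (G : Subgroup (TreeAut X)) (n : ℕ) : ℕ :=
  {g : TreeAut X | g ∈ G ∧ ∃ P, IsPortrait (nucleus G) g P ∧ P.depth ≤ n}.ncard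

/-! ## The first Grigorchuk group -/

/-- Names for the four generators. -/
inductive Gen where
  | a | b | c | d

/-- The action of the generators on words over `{false, true}`: the letter `a` exchanges the two
subtrees on level 1, and `b = (a, c)`, `c = (a, d)`, `d = (1, b)`, where the first section is at
the vertex `false` and the second one at the vertex `true`. -/
def Gen.act : Gen → List Bool → List Bool
  | _, [] => []
  | .a, x :: w => (!x) :: w
  | .b, false :: w => false :: Gen.act .a w
  | .b, true :: w => true :: Gen.act .c w
  | .c, false :: w => false :: Gen.act .a w
  | .c, true :: w => true :: Gen.act .d w
  | .d, false :: w => false :: w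
  | .d, true :: w => true :: Gen.act .b w

theorem Gen.act_act (s : Gen) (w : List Bool) : s.act (s.act w) = w := by
  induction w generalizing s with
  | nil => simp [Gen.act]
  | cons x w ih => cases s <;> cases x <;> simp [Gen.act, ih]

theorem Gen.act_child (s : Gen) (u : List Bool) (x : Bool) :
    ∃ y, s.act (u ++ [x]) = s.act u ++ [y] := by
  induction u generalizing s with
  | nil => cases s <;> cases x <;> simp [Gen.act]
  | cons z u ih => cases s <;> cases z <;> simp [Gen.act, ih]

/-- An involution of the words that fixes the empty word and maps children of `u` to children of
the image of `u` is a tree automorphism. -/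
def ofInvolution (f : List X → List X) (hinv : ∀ w, f (f w) = w) (hnil : f [] = [])
    (hchild : ∀ u x, ∃ y, f (u ++ [x]) = f u ++ [y]) : TreeAut X :=
  ⟨⟨f, f, hinv, hinv⟩, by
    have key : ∀ u v, (tree X).Adj u v → (tree X).Adj (f u) (f v) := by
      rintro u v ⟨x, rfl | rfl⟩
      · obtain ⟨y, hy⟩ := hchild u x
        exact ⟨y, Or.inl hy⟩
      · obtain ⟨y, hy⟩ := hchild v x
        exact ⟨y, Or.inr hy⟩
    refine ⟨hnil, fun u v => ⟨fun h => ?_, key u v⟩⟩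
    have h1 := key _ _ h
    simpa [hinv] using h1⟩

/-- The tree automorphisms `a`, `b`, `c`, `d`. -/
def Gen.aut (s : Gen) : TreeAut Bool :=
  ofInvolution s.act s.act_act (by simp [Gen.act]) s.act_child

/-- The first Grigorchuk group, acting on the binary tree: the group generated by
`a`, `b`, `c`, `d`. -/
def grigorchukGroup : Subgroup (TreeAut Bool) :=
  Subgroup.closure {Gen.a.aut, Gen.b.aut, Gen.c.aut, Gen.d.aut}

end PortraitGrowth

namespace PortraitGrowth

/-! ## Sections of products, and the wreath recursion on the binary tree -/

/-! The nucleus is {1, a, b, c, d} and is closed under sections, so an element has portrait depth at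
most n + 1 exactly when both its level-1 sections have depth at most n (`boundedSet`). Counting
therefore reduces to deciding which triples (level-1 action, g₀, g₁) come from the group.

The answer is a single congruence. Killing b maps the group onto a dihedral group of order 8
generated by the images of a and d (`dih`). A pair g₀, g₁ in the group is realised, with either
action on level 1, if and only if the image of g₁ is that of g₀ after exchanging a and d
(`dih_sec_true`, `exists_mem_of_dih`). Adding one parity bit to the dihedral image yields sixteen
types, and the type of g depends only on its action and the types of its sections
(`typ_eq_combine`). The counts by type thus obey a quadratic recursion; from level 1 on, symmetry
leaves six numbers (`Profile`).

The recursion gives a_n² ≤ 4 a_{n+1} and a_{n+1} ≤ 2 a_n². Hence log(a_n/4)/2^n increases,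
log(2a_n)/2^n decreases, and γ, the supremum of the former, lies between the two. Exact values at
levels 2 and 9 locate γ. -/

theorem treeAut_apply_nil {X : Type*} (g : TreeAut X) : g.1 [] = [] := g.2.1

theorem treeAut_ext {X : Type*} {g h : TreeAut X} (H : ∀ w, g.1 w = h.1 w) : g = h :=
  Subtype.ext (Equiv.ext H)

theorem sectionAt_eq_of_apply {X : Type*} {g h : TreeAut X} {u v : List X}
    (H : ∀ w, g.1 (u ++ w) = v ++ h.1 w) : sectionAt g u = h := by
  have huv : g.1 u = v := by simpa [treeAut_apply_nil] using H []
  refine treeAut_ext fun w => ?_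
  have h1 := H w
  rw [apply_append, huv] at h1
  exact List.append_cancel_left h1

theorem sectionAt_mul {X : Type*} (g h : TreeAut X) (u : List X) :
    sectionAt (g * h) u = sectionAt g (h.1 u) * sectionAt h u := by
  apply sectionAt_eq_of_apply (v := g.1 (h.1 u))
  intro w
  simp [apply_append]

theorem sectionAt_one {X : Type*} (u : List X) : sectionAt (1 : TreeAut X) u = 1 :=
  sectionAt_eq_of_apply (v := u) fun _ => rfl

theorem sectionAt_nil {X : Type*} (g : TreeAut X) : sectionAt g [] = g :=
  sectionAt_eq_of_apply (v := []) fun _ => rfl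

theorem sectionAt_append {X : Type*} (g : TreeAut X) (u v : List X) :
    sectionAt g (u ++ v) = sectionAt (sectionAt g u) v := by
  apply sectionAt_eq_of_apply (v := g.1 (u ++ v))
  intro w
  rw [List.append_assoc, apply_append, apply_append (sectionAt g u), apply_append g u v,
    List.append_assoc]

/-- The section at a vertex of level 1 of the binary tree. -/
def sec (g : TreeAut Bool) (x : Bool) : TreeAut Bool := sectionAt g [x]

/-- The action on level 1: `true` when the two vertices are exchanged. -/
def bit (g : TreeAut Bool) : Bool := g.1 [false] == [true]

theorem sectionAt_cons (g : TreeAut Bool) (x : Bool) (u : List Bool) :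
    sectionAt g (x :: u) = sectionAt (sec g x) u :=
  sectionAt_append g [x] u

theorem apply_singleton (g : TreeAut Bool) (x : Bool) : g.1 [x] = [x ^^ bit g] := by
  obtain ⟨y, hy⟩ := exists_apply_child g [] false
  obtain ⟨z, hz⟩ := exists_apply_child g [] true
  simp only [treeAut_apply_nil, List.nil_append] at hy hz
  have hne : y ≠ z := by
    rintro rfl
    simpa using g.1.injective (hy.trans hz.symm)
  cases x <;> cases y <;> cases z <;> simp_all [bit]

theorem apply_cons (g : TreeAut Bool) (x : Bool) (w : List Bool) :
    g.1 (x :: w) = (x ^^ bit g) :: (sec g x).1 w := by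
  have := apply_append g [x] w
  rwa [apply_singleton] at this

theorem ext_bit_sec {g h : TreeAut Bool} (hb : bit g = bit h) (hs : ∀ x, sec g x = sec h x) :
    g = h := by
  refine treeAut_ext fun w => ?_
  cases w with
  | nil => simp [treeAut_apply_nil]
  | cons x w => rw [apply_cons, apply_cons, hb, hs]

theorem bit_eq {g : TreeAut Bool} {x y : Bool} (h : g.1 [x] = [y]) : bit g = (x ^^ y) := by
  rw [apply_singleton] at h
  cases x <;> cases y <;> cases hb : bit g <;> simp_all

@[simp] theorem sec_one (x : Bool) : sec 1 x = 1 := sectionAt_one _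

@[simp] theorem bit_one : bit 1 = false := rfl

@[simp] theorem sec_mul (g h : TreeAut Bool) (x : Bool) :
    sec (g * h) x = sec g (x ^^ bit h) * sec h x := by
  rw [sec, sectionAt_mul, apply_singleton]
  rfl

@[simp] theorem bit_mul (g h : TreeAut Bool) : bit (g * h) = (bit g ^^ bit h) := by
  have : (g * h).1 [false] = [bit h ^^ bit g] := by
    simp [apply_singleton]
  rw [bit_eq this]
  cases bit g <;> cases bit h <;> rfl

/-! ## The generators -/

theorem Gen.aut_mul_self (s : Gen) : s.aut * s.aut = 1 :=
  treeAut_ext fun w => s.act_act w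

theorem Gen.act_bcd (w : List Bool) :
    (Gen.act .b (Gen.act .c w) = Gen.act .d w ∧ Gen.act .c (Gen.act .b w) = Gen.act .d w) ∧
    (Gen.act .c (Gen.act .d w) = Gen.act .b w ∧ Gen.act .d (Gen.act .c w) = Gen.act .b w) ∧
    (Gen.act .d (Gen.act .b w) = Gen.act .c w ∧ Gen.act .b (Gen.act .d w) = Gen.act .c w) := by
  induction w with
  | nil => simp [Gen.act]
  | cons x w ih => cases x <;> simp [Gen.act, ih, Gen.act_act]

@[simp] theorem a_mul_a : Gen.a.aut * Gen.a.aut = 1 := Gen.aut_mul_self _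
@[simp] theorem b_mul_b : Gen.b.aut * Gen.b.aut = 1 := Gen.aut_mul_self _
@[simp] theorem c_mul_c : Gen.c.aut * Gen.c.aut = 1 := Gen.aut_mul_self _
@[simp] theorem d_mul_d : Gen.d.aut * Gen.d.aut = 1 := Gen.aut_mul_self _

@[simp] theorem b_mul_c : Gen.b.aut * Gen.c.aut = Gen.d.aut :=
  treeAut_ext fun w => (Gen.act_bcd w).1.1
@[simp] theorem c_mul_b : Gen.c.aut * Gen.b.aut = Gen.d.aut :=
  treeAut_ext fun w => (Gen.act_bcd w).1.2
@[simp] theorem c_mul_d : Gen.c.aut * Gen.d.aut = Gen.b.aut :=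
  treeAut_ext fun w => (Gen.act_bcd w).2.1.1
@[simp] theorem d_mul_c : Gen.d.aut * Gen.c.aut = Gen.b.aut :=
  treeAut_ext fun w => (Gen.act_bcd w).2.1.2
@[simp] theorem d_mul_b : Gen.d.aut * Gen.b.aut = Gen.c.aut :=
  treeAut_ext fun w => (Gen.act_bcd w).2.2.1
@[simp] theorem b_mul_d : Gen.b.aut * Gen.d.aut = Gen.c.aut :=
  treeAut_ext fun w => (Gen.act_bcd w).2.2.2

@[simp] theorem bit_a : bit Gen.a.aut = true := bit_eq (x := false) (y := true) rfl
@[simp] theorem bit_b : bit Gen.b.aut = false := bit_eq (x := false) (y := false) rfl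
@[simp] theorem bit_c : bit Gen.c.aut = false := bit_eq (x := false) (y := false) rfl
@[simp] theorem bit_d : bit Gen.d.aut = false := bit_eq (x := false) (y := false) rfl

@[simp] theorem sec_a (x : Bool) : sec Gen.a.aut x = 1 :=
  sectionAt_eq_of_apply (v := [!x]) fun _ => rfl
@[simp] theorem sec_b_false : sec Gen.b.aut false = Gen.a.aut :=
  sectionAt_eq_of_apply (v := [false]) fun _ => rfl
@[simp] theorem sec_b_true : sec Gen.b.aut true = Gen.c.aut :=
  sectionAt_eq_of_apply (v := [true]) fun _ => rfl
@[simp] theorem sec_c_false : sec Gen.c.aut false = Gen.a.aut :=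
  sectionAt_eq_of_apply (v := [false]) fun _ => rfl
@[simp] theorem sec_c_true : sec Gen.c.aut true = Gen.d.aut :=
  sectionAt_eq_of_apply (v := [true]) fun _ => rfl
@[simp] theorem sec_d_false : sec Gen.d.aut false = 1 :=
  sectionAt_eq_of_apply (v := [false]) fun _ => rfl
@[simp] theorem sec_d_true : sec Gen.d.aut true = Gen.b.aut :=
  sectionAt_eq_of_apply (v := [true]) fun _ => rfl

theorem Gen.aut_mem (s : Gen) : s.aut ∈ grigorchukGroup :=
  Subgroup.subset_closure (by cases s <;> simp)

/-- Induction on elements of the Grigorchuk group by right multiplication with generators. -/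
theorem grigorchuk_induction {p : ∀ g, g ∈ grigorchukGroup → Prop} (one : p 1 (one_mem _))
    (mul : ∀ g hg, ∀ s : Gen, p g hg → p (g * s.aut) (mul_mem hg s.aut_mem))
    {g : TreeAut Bool} (hg : g ∈ grigorchukGroup) : p g hg := by
  have hgen : ∀ y ∈ ({Gen.a.aut, Gen.b.aut, Gen.c.aut, Gen.d.aut} : Set (TreeAut Bool)),
      ∃ s : Gen, y = s.aut := by
    rintro y (rfl | rfl | rfl | rfl)
    exacts [⟨_, rfl⟩, ⟨_, rfl⟩, ⟨_, rfl⟩, ⟨_, rfl⟩]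
  induction hg using Subgroup.closure_induction_right with
  | one => exact one
  | mul_right x hx y hy ih =>
    obtain ⟨s, rfl⟩ := hgen y hy
    exact mul x hx s ih
  | mul_inv_cancel x hx y hy ih =>
    obtain ⟨s, rfl⟩ := hgen y hy
    simpa only [inv_eq_of_mul_eq_one_right s.aut_mul_self] using mul x hx s ih

/-! ## The nucleus -/

/-- The set `{1, a, b, c, d}`. -/
def nucleusSet : Set (TreeAut Bool) :=
  {1, Gen.a.aut, Gen.b.aut, Gen.c.aut, Gen.d.aut}

theorem Gen.aut_mem_nucleusSet (s : Gen) : s.aut ∈ nucleusSet := by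
  cases s <;> simp [nucleusSet]

theorem sec_mem_nucleusSet {g : TreeAut Bool} (hg : g ∈ nucleusSet) (x : Bool) :
    sec g x ∈ nucleusSet := by
  rcases hg with rfl | rfl | rfl | rfl | rfl <;> cases x <;> simp [nucleusSet]

theorem sectionAt_mem_nucleusSet {g : TreeAut Bool} (hg : g ∈ nucleusSet) (u : List Bool) :
    sectionAt g u ∈ nucleusSet := by
  induction u generalizing g with
  | nil => rwa [sectionAt_nil]
  | cons x u ih =>
    rw [sectionAt_cons]
    exact ih (sec_mem_nucleusSet hg x)

theorem sec_mul_mem_nucleusSet {g h : TreeAut Bool} (hg : g ∈ nucleusSet) (hh : h ∈ nucleusSet)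
    (x : Bool) : sec (g * h) x ∈ nucleusSet := by
  rcases hg with rfl | rfl | rfl | rfl | rfl <;> rcases hh with rfl | rfl | rfl | rfl | rfl <;>
    cases x <;> simp [nucleusSet]

theorem nucleusSet_subset : nucleusSet ⊆ grigorchukGroup := by
  rintro g (rfl | rfl | rfl | rfl | rfl)
  exacts [one_mem _, Gen.aut_mem _, Gen.aut_mem _, Gen.aut_mem _, Gen.aut_mem _]

/-- If the sections of g lie in the set from level n on, those of g·s there are products of two
elements of the set, and one further level brings such products back into it. -/
theorem nucleusSet_mem_contractingSets : nucleusSet ∈ contractingSets grigorchukGroup := by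
  refine ⟨by simp [nucleusSet], nucleusSet_subset, fun g hg => ?_⟩
  induction hg using grigorchuk_induction with
  | one => exact ⟨0, fun u _ => sectionAt_mem_nucleusSet (by simp [nucleusSet]) u⟩
  | mul g _ s ih =>
    obtain ⟨n, hn⟩ := ih
    refine ⟨n + 1, fun u hu => ?_⟩
    obtain ⟨v, x, w, hv, rfl⟩ : ∃ v x w, n ≤ v.length ∧ u = v ++ x :: w := by
      refine ⟨u.take n, u[n], u.drop (n + 1), ?_, ?_⟩
      · simp; omega
      · simp
    rw [sectionAt_append, sectionAt_cons, sectionAt_mul]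
    refine sectionAt_mem_nucleusSet (sec_mul_mem_nucleusSet (hn _ ?_)
      (sectionAt_mem_nucleusSet s.aut_mem_nucleusSet v) x) w
    have hlen : ∀ (h : TreeAut Bool) (v : List Bool), (h.1 v).length = v.length := by
      intro h v
      induction v generalizing h with
      | nil => simp [treeAut_apply_nil]
      | cons x v ih => rw [apply_cons]; simp [ih]
    rwa [hlen]

/-- Taking the section at `true` cycles b → c → d → b, so b, c and d recur as sections at every
depth along the rightmost ray. Then a and 1 occur as sections of b and d. -/
theorem nucleusSet_subset_of_mem {M : Set (TreeAut Bool)}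
    (hM : M ∈ contractingSets grigorchukGroup) : nucleusSet ⊆ M := by
  have key : ∀ k, ∀ t : Gen, t ≠ .a → ∃ s : Gen, s ≠ .a ∧
      sectionAt s.aut (List.replicate k true) = t.aut := by
    intro k
    induction k with
    | zero => exact fun t ht => ⟨t, ht, sectionAt_nil _⟩
    | succ k ih =>
      intro t ht
      obtain ⟨s, hs, h⟩ := ih t ht
      cases s with
      | a => exact absurd rfl hs
      | b => exact ⟨.d, by simp, by rw [List.replicate_succ, sectionAt_cons, sec_d_true, h]⟩
      | c => exact ⟨.b, by simp, by rw [List.replicate_succ, sectionAt_cons, sec_b_true, h]⟩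
      | d => exact ⟨.c, by simp, by rw [List.replicate_succ, sectionAt_cons, sec_c_true, h]⟩
  have key2 : ∀ t : Gen, t ≠ .a → ∀ v : List Bool, sectionAt t.aut v ∈ M := by
    intro t ht v
    choose f hf using fun s : Gen => hM.2.2 s.aut s.aut_mem
    -- The sum is a level deep enough for all four generators at once.
    obtain ⟨s, -, h⟩ := key (f .a + f .b + f .c + f .d) t ht
    rw [← h, ← sectionAt_append]
    refine hf s _ ?_
    cases s <;> simp <;> omega
  rintro g (rfl | rfl | rfl | rfl | rfl)
  · rw [← sec_d_false]
    exact key2 .d (by simp) _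
  · rw [← sec_b_false]
    exact key2 .b (by simp) _
  · simpa [sectionAt_nil] using key2 .b (by simp) []
  · simpa [sectionAt_nil] using key2 .c (by simp) []
  · simpa [sectionAt_nil] using key2 .d (by simp) []

theorem nucleus_grigorchukGroup : nucleus grigorchukGroup = nucleusSet :=
  Set.Subset.antisymm (Set.sInter_subset_of_mem nucleusSet_mem_contractingSets)
    (Set.subset_sInter fun _ => nucleusSet_subset_of_mem)

/-! ## Portraits of bounded depth -/

/-- The elements of the Grigorchuk group whose portrait has depth at most `n`. -/
def boundedSet : ℕ → Set (TreeAut Bool)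
  | 0 => nucleusSet
  | n + 1 => {g | g ∈ grigorchukGroup ∧ ∀ x, sec g x ∈ boundedSet n}

theorem boundedSet_subset (n : ℕ) : boundedSet n ⊆ grigorchukGroup := by
  cases n with
  | zero => exact nucleusSet_subset
  | succ n => exact fun g hg => hg.1

/-- This is why `boundedSet` needs no separate case for portraits that stop early. -/
theorem nucleusSet_subset_boundedSet (n : ℕ) : nucleusSet ⊆ boundedSet n := by
  induction n with
  | zero => exact subset_rfl
  | succ n ih => exact fun g hg => ⟨nucleusSet_subset hg, fun x => ih (sec_mem_nucleusSet hg x)⟩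

theorem exists_perm (g : TreeAut Bool) : ∃ α : Equiv.Perm Bool, ∀ x, g.1 [x] = [α x] := by
  refine ⟨⟨(· ^^ bit g), (· ^^ bit g), fun x => by simp, fun x => by simp⟩, fun x => ?_⟩
  rw [apply_singleton]
  rfl

/-! ## Finite invariants -/

/-- The parity of the number of active vertices on level 1. -/
def par1 (g : TreeAut Bool) : Bool := bit (sec g false) ^^ bit (sec g true)

/-- The parity of the number of active vertices on level 2. -/
def par2 (g : TreeAut Bool) : Bool := par1 (sec g false) ^^ par1 (sec g true)

@[simp] theorem par1_mul (g h : TreeAut Bool) : par1 (g * h) = (par1 g ^^ par1 h) := by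
  simp only [par1, sec_mul, bit_mul]
  cases bit h <;> simp [Bool.xor_comm, Bool.xor_left_comm]

@[simp] theorem par2_mul (g h : TreeAut Bool) : par2 (g * h) = (par2 g ^^ par2 h) := by
  simp only [par2, sec_mul, par1_mul]
  cases bit h <;> simp [Bool.xor_comm, Bool.xor_left_comm]

@[simp] theorem par1_one : par1 1 = false := by simp [par1]
@[simp] theorem par2_one : par2 1 = false := by simp [par2]
@[simp] theorem par1_a : par1 Gen.a.aut = false := by simp [par1]
@[simp] theorem par1_b : par1 Gen.b.aut = true := by simp [par1]
@[simp] theorem par1_c : par1 Gen.c.aut = true := by simp [par1]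
@[simp] theorem par1_d : par1 Gen.d.aut = false := by simp [par1]
@[simp] theorem par2_a : par2 Gen.a.aut = false := by simp [par2]
@[simp] theorem par2_b : par2 Gen.b.aut = true := by simp [par2]
@[simp] theorem par2_c : par2 Gen.c.aut = false := by simp [par2]
@[simp] theorem par2_d : par2 Gen.d.aut = true := by simp [par2]

/-- Underlying set of the dihedral group of order 8, realised as the wreath product of two groups
of order 2: a triple consists of two base coordinates and the top coordinate. -/
abbrev Dih := Bool × Bool × Bool

/-- The product of the dihedral group of order 8. -/
def Dih.mul (x y : Dih) : Dih :=
  ((bif y.2.2 then x.2.1 else x.1) ^^ y.1, (bif y.2.2 then x.1 else x.2.1) ^^ y.2.1,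
    x.2.2 ^^ y.2.2)

/-- The automorphism of the dihedral group exchanging the images of `a` and `d`. -/
def Dih.swap (x : Dih) : Dih :=
  let s := bif x.1 then !(x.2.2 && !x.2.1) else x.2.1 && x.2.2
  (s, s ^^ x.2.2, x.1 ^^ x.2.1)

theorem Dih.swap_mul : ∀ x y : Dih, (x.mul y).swap = x.swap.mul y.swap := by decide

theorem Dih.mul_one : ∀ x : Dih, x.mul (false, false, false) = x := by decide

theorem Dih.swap_swap : ∀ x : Dih, x.swap.swap = x := by decide

/-- The homomorphism to the dihedral group of order 8. -/
def dih (g : TreeAut Bool) : Dih := (par2 (sec g false), par2 (sec g true), bit g)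

theorem dih_mul (g h : TreeAut Bool) : dih (g * h) = (dih g).mul (dih h) := by
  simp only [dih, sec_mul, par2_mul, bit_mul, Dih.mul]
  cases bit h <;> simp

@[simp] theorem dih_one : dih 1 = (false, false, false) := by simp [dih]
@[simp] theorem dih_a : dih Gen.a.aut = (false, false, true) := by simp [dih]
@[simp] theorem dih_b : dih Gen.b.aut = (false, false, false) := by simp [dih]
@[simp] theorem dih_c : dih Gen.c.aut = (false, true, false) := by simp [dih]
@[simp] theorem dih_d : dih Gen.d.aut = (false, true, false) := by simp [dih]

/-- The parities of active vertices on levels 1, 2 and 3 sum to zero: each is additive, and the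
relation holds on the generators. -/
theorem par2_eq {g : TreeAut Bool} (hg : g ∈ grigorchukGroup) :
    par2 g = (par1 g ^^ par2 (sec g false) ^^ par2 (sec g true)) := by
  induction hg using grigorchuk_induction with
  | one => simp
  | mul g _ s ih =>
    simp only [par2_mul, par1_mul, sec_mul, ih]
    cases s <;> cases par1 g <;> simp [Bool.xor_comm]

/-! ## Membership in the Grigorchuk group -/

/-- The sections of b and c map to the images of a and d, and both sections of d map to the
identity. Multiplication by a interchanges the sections, which is harmless because `Dih.swap` is an
involution. -/
theorem sec_mem_and_dih {g : TreeAut Bool} (hg : g ∈ grigorchukGroup) :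
    (∀ x, sec g x ∈ grigorchukGroup) ∧ dih (sec g true) = (dih (sec g false)).swap := by
  induction hg using grigorchuk_induction with
  | one => exact ⟨by simp [one_mem], by simp [Dih.swap]⟩
  | mul g _ s ih =>
    obtain ⟨h1, h2⟩ := ih
    constructor
    · intro x
      rw [sec_mul]
      refine mul_mem (h1 _) ?_
      cases s <;> cases x <;> simp [one_mem, Gen.aut_mem]
    · have h3 : dih (sec g false) = (dih (sec g true)).swap := by rw [h2, Dih.swap_swap]
      cases s <;> simp [dih_mul, h2, Dih.swap_mul, Dih.swap_swap]
      all_goals first | rfl | exact Dih.mul_one _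

theorem sec_mem {g : TreeAut Bool} (hg : g ∈ grigorchukGroup) (x : Bool) :
    sec g x ∈ grigorchukGroup := (sec_mem_and_dih hg).1 x

theorem dih_sec_true {g : TreeAut Bool} (hg : g ∈ grigorchukGroup) :
    dih (sec g true) = (dih (sec g false)).swap := (sec_mem_and_dih hg).2

/-- The level-1 stabiliser contains b, c, d and their conjugates by a, whose sections at either
vertex include all generators. -/
theorem exists_stabilizer_sec_eq (y : TreeAut Bool) (hy : y ∈ grigorchukGroup) (x : Bool) :
    ∃ h ∈ grigorchukGroup, bit h = false ∧ sec h x = y := by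
  induction hy using grigorchuk_induction with
  | one => exact ⟨1, one_mem _, by simp⟩
  | mul g _ s ih =>
    obtain ⟨h, hh, h1, h2⟩ := ih
    have hs : ∃ k ∈ grigorchukGroup, bit k = false ∧ sec k x = s.aut := by
      have ha := Gen.a.aut_mem
      have hb := Gen.b.aut_mem
      have hc := Gen.c.aut_mem
      have hd := Gen.d.aut_mem
      cases x
      · cases s
        · exact ⟨_, hb, by simp⟩
        · exact ⟨_, mul_mem (mul_mem ha hd) ha, by simp⟩
        · exact ⟨_, mul_mem (mul_mem ha hb) ha, by simp⟩
        · exact ⟨_, mul_mem (mul_mem ha hc) ha, by simp⟩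
      · cases s
        · exact ⟨_, mul_mem (mul_mem ha hb) ha, by simp⟩
        · exact ⟨_, hd, by simp⟩
        · exact ⟨_, hb, by simp⟩
        · exact ⟨_, hc, by simp⟩
    obtain ⟨k, hk, k1, k2⟩ := hs
    exact ⟨h * k, mul_mem hh hk, by simp [h1, k1], by simp [h2, k1, k2]⟩

/-- The elements `y` such that `(1, y)` belongs to the Grigorchuk group. -/
def rightFactor : Subgroup (TreeAut Bool) where
  carrier := {y | ∃ h ∈ grigorchukGroup, bit h = false ∧ sec h false = 1 ∧ sec h true = y}
  one_mem' := ⟨1, one_mem _, by simp⟩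
  mul_mem' := by
    rintro _ _ ⟨h, hh, h1, h2, rfl⟩ ⟨k, hk, k1, k2, rfl⟩
    exact ⟨h * k, mul_mem hh hk, by simp [h1, h2, k1, k2]⟩
  inv_mem' := by
    rintro _ ⟨h, hh, h1, h2, rfl⟩
    have hb : bit h⁻¹ = false := by simpa [h1] using (bit_mul h⁻¹ h).symm
    have e (x : Bool) : sec h⁻¹ x * sec h x = 1 := by
      simpa [h1] using (sec_mul h⁻¹ h x).symm
    refine ⟨h⁻¹, inv_mem hh, hb, ?_, eq_inv_of_mul_eq_one_left (e true)⟩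
    simpa [h2] using e false

/-- Normality: lift g to an element k of the level-1 stabiliser with g as its section at `true`, and
conjugate (1, y) by k. -/
theorem conj_mem_rightFactor {y g : TreeAut Bool} (hy : y ∈ rightFactor)
    (hg : g ∈ grigorchukGroup) : g * y * g⁻¹ ∈ rightFactor := by
  obtain ⟨h, hh, h1, h2, rfl⟩ := hy
  obtain ⟨k, hk, k1, rfl⟩ := exists_stabilizer_sec_eq g hg true
  have hb : bit k⁻¹ = false := by simpa [k1] using (bit_mul k⁻¹ k).symm
  have e (x : Bool) : sec k⁻¹ x = (sec k x)⁻¹ :=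
    eq_inv_of_mul_eq_one_left (by simpa [k1] using (sec_mul k⁻¹ k x).symm)
  exact ⟨k * h * k⁻¹, mul_mem (mul_mem hk hh) (inv_mem hk), by simp [k1, h1, hb],
    by simp [hb, h1, h2, e], by simp [hb, h1, e]⟩

theorem b_mem_rightFactor : Gen.b.aut ∈ rightFactor :=
  ⟨Gen.d.aut, Gen.aut_mem _, by simp⟩

/-- Representatives in the Grigorchuk group of the elements of its dihedral quotient. -/
def Dih.rep : Dih → TreeAut Bool
  | (false, false, false) => 1
  | (false, false, true) => Gen.a.aut
  | (false, true, false) => Gen.d.aut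
  | (false, true, true) => Gen.a.aut * Gen.d.aut
  | (true, false, true) => Gen.d.aut * Gen.a.aut
  | (true, false, false) => Gen.a.aut * Gen.d.aut * Gen.a.aut
  | (true, true, true) => Gen.d.aut * Gen.a.aut * Gen.d.aut
  | (true, true, false) => Gen.a.aut * Gen.d.aut * Gen.a.aut * Gen.d.aut

theorem Dih.rep_mem (x : Dih) : x.rep ∈ grigorchukGroup := by
  have ha := Gen.a.aut_mem
  have hd := Gen.d.aut_mem
  have had := mul_mem ha hd
  have hda := mul_mem hd ha
  have hada := mul_mem had ha
  obtain ⟨_ | _, _ | _, _ | _⟩ := x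
  exacts [one_mem _, ha, hd, had, hada, hda, mul_mem hada hd, mul_mem hda hd]

theorem d_a_d_a :
    Gen.d.aut * Gen.a.aut * Gen.d.aut * Gen.a.aut =
      Gen.a.aut * Gen.d.aut * Gen.a.aut * Gen.d.aut := by
  refine ext_bit_sec (by simp) fun x => ?_
  cases x <;> simp

theorem Dih.rep_mul_a (x : Dih) :
    x.rep * Gen.a.aut = (x.mul (false, false, true)).rep := by
  obtain ⟨_ | _, _ | _, _ | _⟩ := x <;> simp [Dih.mul, Dih.rep, mul_assoc]
  · simpa [mul_assoc] using congrArg (· * Gen.a.aut) d_a_d_a.symm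
  · simpa [mul_assoc] using d_a_d_a

theorem Dih.rep_mul_d (x : Dih) :
    x.rep * Gen.d.aut = (x.mul (false, true, false)).rep := by
  obtain ⟨_ | _, _ | _, _ | _⟩ := x <;> simp [Dih.mul, Dih.rep, mul_assoc]

/-- Modulo the normal subgroup `rightFactor`, which contains b, the letter c = db acts as d. Only a
and d remain, and they satisfy the dihedral relations, so elements with equal `dih` are congruent.
-/
theorem mul_rep_inv_mem_rightFactor {g : TreeAut Bool} (hg : g ∈ grigorchukGroup) :
    g * (dih g).rep⁻¹ ∈ rightFactor := by
  have hb {g : TreeAut Bool} (x : Dih) (h : g * x.rep⁻¹ ∈ rightFactor) :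
      g * Gen.b.aut * x.rep⁻¹ ∈ rightFactor := by
    have := mul_mem h (conj_mem_rightFactor b_mem_rightFactor x.rep_mem)
    simpa [mul_assoc] using this
  have hd {g : TreeAut Bool} (x : Dih) (h : g * x.rep⁻¹ ∈ rightFactor) :
      g * Gen.d.aut * (x.mul (false, true, false)).rep⁻¹ ∈ rightFactor := by
    rw [← Dih.rep_mul_d]
    simpa [mul_assoc] using h
  induction hg using grigorchuk_induction with
  | one => simp [Dih.rep, one_mem]
  | mul g _ s ih =>
    rw [dih_mul]
    cases s
    · rw [dih_a, ← Dih.rep_mul_a]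
      simpa [mul_assoc] using ih
    · rw [dih_b, Dih.mul_one]
      exact hb _ ih
    · rw [dih_c, ← d_mul_b, ← mul_assoc]
      exact hb _ (hd _ ih)
    · rw [dih_d]
      exact hd _ ih

theorem exists_mem_of_dih {g₀ g₁ : TreeAut Bool} (h₀ : g₀ ∈ grigorchukGroup)
    (h₁ : g₁ ∈ grigorchukGroup) (h : dih g₁ = (dih g₀).swap) (r : Bool) :
    ∃ g ∈ grigorchukGroup, bit g = r ∧ sec g false = g₀ ∧ sec g true = g₁ := by
  -- Realise g₀ first; the second section of k then has the same dihedral image as g₁, and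
  -- multiplying by (1, g₁ k₁⁻¹) corrects it.
  obtain ⟨k, hk, k1, rfl⟩ := exists_stabilizer_sec_eq g₀ h₀ false
  have h2 : g₁ * (sec k true)⁻¹ ∈ rightFactor := by
    have e1 := mul_rep_inv_mem_rightFactor h₁
    have e2 := mul_rep_inv_mem_rightFactor (sec_mem hk true)
    rw [dih_sec_true hk, ← h] at e2
    simpa [mul_assoc] using mul_mem e1 (inv_mem e2)
  obtain ⟨l, hl, l1, l2, l3⟩ := h2
  cases r
  · exact ⟨l * k, mul_mem hl hk, by simp [l1, k1], by simp [k1, l2], by simp [k1, l3]⟩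
  · have ha := Gen.a.aut_mem
    -- Left multiplication by a changes the action on level 1 but neither section.
    exact ⟨Gen.a.aut * (l * k), mul_mem ha (mul_mem hl hk), by simp [l1, k1], by simp [k1, l2],
      by simp [k1, l3]⟩

/-! ## Portraits -/

theorem exists_isPortrait_iff {g : TreeAut Bool} (hg : g ∈ grigorchukGroup) (n : ℕ) :
    (∃ P, IsPortrait nucleusSet g P ∧ P.depth ≤ n) ↔ g ∈ boundedSet n := by
  induction n generalizing g with
  | zero =>
    constructor
    · rintro ⟨P, hP, hd⟩
      cases hP with
      | leaf _ h => exact h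
      | node => simp [Portrait.depth] at hd
    · exact fun h => ⟨.leaf g, .leaf g h, le_rfl⟩
  | succ n ih =>
    constructor
    · rintro ⟨P, hP, hd⟩
      cases hP with
      | leaf _ h => exact nucleusSet_subset_boundedSet _ h
      | node _ h α hα child hc =>
        refine ⟨hg, fun x => (ih (sec_mem hg x)).1 ⟨child x, hc x, ?_⟩⟩
        have h1 : (child x).depth ≤ Finset.univ.sup fun x => (child x).depth :=
          Finset.le_sup (f := fun x => (child x).depth) (Finset.mem_univ x)
        simp only [Portrait.depth] at hd
        omega
    · rintro ⟨-, h⟩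
      by_cases hN : g ∈ nucleusSet
      · exact ⟨.leaf g, .leaf g hN, Nat.zero_le _⟩
      · choose child hc hd using fun x => (ih (sec_mem hg x)).2 (h x)
        obtain ⟨α, hα⟩ := exists_perm g
        refine ⟨.node α child, .node g hN α hα child hc, ?_⟩
        have h1 : (Finset.univ.sup fun x => (child x).depth) ≤ n :=
          Finset.sup_le fun x _ => hd x
        simp only [Portrait.depth]
        omega

theorem portraitGrowth_grigorchukGroup (n : ℕ) :
    portraitGrowth grigorchukGroup n = (boundedSet n).ncard := by
  rw [portraitGrowth, nucleus_grigorchukGroup]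
  congr 1
  ext g
  exact ⟨fun h => (exists_isPortrait_iff h.1 n).1 h.2,
    fun h => ⟨boundedSet_subset n h, (exists_isPortrait_iff (boundedSet_subset n h) n).2 h⟩⟩

/-! ## Counting by type -/

/-- The finite set of types: a dihedral element together with a parity. -/
abbrev Ty := Dih × Bool

/-- The type of a tree automorphism. -/
def typ (g : TreeAut Bool) : Ty := (dih g, par1 g)

/-- The parity of level 2, read off from the type. -/
def Ty.parity (t : Ty) : Bool := t.2 ^^ t.1.1 ^^ t.1.2.1

/-- The type of an element of the Grigorchuk group with given action on level 1 and with sections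
of given types. -/
def Ty.combine (r : Bool) (t₀ t₁ : Ty) : Ty :=
  ((t₀.parity, t₁.parity, r), t₀.1.2.2 ^^ t₁.1.2.2)

/-- The dihedral image of g needs the level-2 parities of its sections; by `par2_eq` these are
visible in the sections' types. This closure is the reason for recording `par1`. -/
theorem typ_eq_combine {g : TreeAut Bool} (hg : g ∈ grigorchukGroup) :
    typ g = Ty.combine (bit g) (typ (sec g false)) (typ (sec g true)) := by
  have h (x : Bool) : par2 (sec g x) = (typ (sec g x)).parity := by
    rw [par2_eq (sec_mem hg x), Ty.parity]
    rfl
  rw [typ, dih, h, h]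
  rfl

theorem boundedSet_finite (n : ℕ) : (boundedSet n).Finite := by
  induction n with
  | zero => exact nucleusSet_mem_contractingSets.1
  | succ n ih =>
    refine Set.Finite.of_injOn (f := fun g => (bit g, sec g false, sec g true))
      (t := Set.univ ×ˢ boundedSet n ×ˢ boundedSet n) (fun g hg => ?_) ?_
      (Set.finite_univ.prod (ih.prod ih))
    · exact ⟨trivial, hg.2 false, hg.2 true⟩
    · intro g _ h _ H
      simp only [Prod.mk.injEq] at H
      exact ext_bit_sec H.1 fun x => by cases x <;> simp [H]

open Classical in
/-- The elements of given type whose portrait has depth at most `n`. -/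
noncomputable def typeFinset (n : ℕ) (t : Ty) : Finset (TreeAut Bool) :=
  (boundedSet_finite n).toFinset.filter (typ · = t)

theorem mem_typeFinset {n : ℕ} {t : Ty} {g : TreeAut Bool} :
    g ∈ typeFinset n t ↔ g ∈ boundedSet n ∧ typ g = t := by
  simp [typeFinset]

theorem ncard_boundedSet (n : ℕ) : (boundedSet n).ncard = ∑ t, (typeFinset n t).card := by
  classical
  rw [Set.ncard_eq_toFinset_card _ (boundedSet_finite n),
    Finset.card_eq_sum_card_fiberwise (f := typ) (t := Finset.univ) (fun _ _ => by simp)]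
  congr! 2

/-- The type t fixes the level-1 action, so g corresponds to its pair of sections; the swap
condition says exactly which pairs occur. -/
theorem card_typeFinset_succ (n : ℕ) (t : Ty) :
    (typeFinset (n + 1) t).card = ∑ p : Ty × Ty,
      if p.2.1 = p.1.1.swap ∧ Ty.combine t.1.2.2 p.1 p.2 = t then
        (typeFinset n p.1).card * (typeFinset n p.2).card else 0 := by
  classical
  rw [Finset.card_eq_sum_card_fiberwise (f := fun g => (typ (sec g false), typ (sec g true)))
    (t := Finset.univ) (fun _ _ => by simp)]
  refine Finset.sum_congr rfl fun p _ => ?_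
  obtain ⟨t₀, t₁⟩ := p
  split_ifs with H
  · obtain ⟨H1, H2⟩ := H
    rw [← Finset.card_product]
    refine Finset.card_nbij (fun g => (sec g false, sec g true)) ?_ ?_ ?_
    · intro g hg
      simp only [Finset.mem_coe, Finset.mem_filter, mem_typeFinset, Prod.mk.injEq] at hg
      simp only [Finset.mem_coe, Finset.mem_product, mem_typeFinset]
      exact ⟨⟨hg.1.1.2 _, hg.2.1⟩, hg.1.1.2 _, hg.2.2⟩
    · intro g hg h hh e
      simp only [Finset.coe_filter, Set.mem_ofPred_eq, mem_typeFinset] at hg hh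
      simp only [Prod.mk.injEq] at e
      refine ext_bit_sec ?_ fun x => by cases x <;> simp [e]
      have := hg.1.2.trans hh.1.2.symm
      exact congrArg (fun t : Ty => t.1.2.2) this
    · rintro ⟨g₀, g₁⟩ hg
      simp only [Finset.coe_product, Set.mem_prod, Finset.mem_coe, mem_typeFinset] at hg
      obtain ⟨⟨h0, rfl⟩, h1, rfl⟩ := hg
      obtain ⟨g, hg, hr, rfl, rfl⟩ := exists_mem_of_dih (boundedSet_subset n h0)
        (boundedSet_subset n h1) H1 t.1.2.2
      refine ⟨g, ?_, rfl⟩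
      simp only [Finset.coe_filter, Set.mem_ofPred_eq, mem_typeFinset, and_true]
      refine ⟨⟨hg, fun x => by cases x <;> assumption⟩, ?_⟩
      rw [typ_eq_combine hg, hr, H2]
  · rw [Finset.card_eq_zero, Finset.eq_empty_iff_forall_notMem]
    intro g hg
    simp only [Finset.mem_filter, mem_typeFinset, Prod.mk.injEq] at hg
    obtain ⟨⟨hg, rfl⟩, rfl, rfl⟩ := hg
    exact H ⟨dih_sec_true hg.1, (typ_eq_combine hg.1).symm⟩

/-! ## The growth recursion -/

theorem card_typeFinset_zero (t : Ty) :
    (typeFinset 0 t).card =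
      if t = ((false, false, false), false) ∨ t = ((false, false, true), false) ∨
        t = ((false, false, false), true) ∨ t = ((false, true, false), true) ∨
        t = ((false, true, false), false) then 1 else 0 := by
  classical
  have h : typeFinset 0 t = ({1, Gen.a.aut, Gen.b.aut, Gen.c.aut, Gen.d.aut} :
      Finset (TreeAut Bool)).filter (typ · = t) := by
    ext g
    simp [mem_typeFinset, boundedSet, nucleusSet]
  rw [h]
  obtain ⟨⟨_ | _, _ | _, _ | _⟩, _ | _⟩ := t <;>
    simp [Finset.filter_insert, Finset.filter_singleton, typ]

/-- The numbers of elements of portrait depth at most `n`, for each of the six classes of types on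
which these numbers are constant when `n` is positive. -/
structure Profile where
  (x y z w u v : ℕ)

/-- The number of elements of a given type. -/
def Profile.count (p : Profile) : Ty → ℕ
  | ((false, false, _), false) => p.x
  | ((false, false, _), true) => p.y
  | ((true, true, _), false) => p.u
  | ((true, true, _), true) => p.v
  | (_, false) => p.z
  | (_, true) => p.w

/-- The recursion satisfied by the six numbers. -/
def Profile.next (p : Profile) : Profile where
  x := p.x ^ 2 + 2 * p.w ^ 2 + p.u ^ 2
  y := 2 * p.w * (p.x + p.u)
  z := p.x * p.y + 2 * p.w * p.z + p.u * p.v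
  w := p.z * (p.x + p.u) + p.w * (p.y + p.v)
  u := p.y ^ 2 + 2 * p.z ^ 2 + p.v ^ 2
  v := 2 * p.z * (p.y + p.v)

/-- The total number of elements. -/
def Profile.total (p : Profile) : ℕ := 2 * (p.x + p.y) + 4 * (p.z + p.w) + 2 * (p.u + p.v)

/-- The profile at positive level `n + 1`. -/
def profile : ℕ → Profile
  | 0 => ⟨1, 2, 1, 1, 1, 0⟩
  | n + 1 => (profile n).next

theorem Profile.sum_count (p : Profile) : ∑ t, p.count t = p.total := by
  simp [Fintype.sum_prod_type, Profile.count, Profile.total]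
  ring

set_option maxHeartbeats 4000000 in
theorem Profile.sum_next (p : Profile) (t : Ty) :
    (∑ q : Ty × Ty, if q.2.1 = q.1.1.swap ∧ Ty.combine t.1.2.2 q.1 q.2 = t then
        p.count q.1 * p.count q.2 else 0) = p.next.count t := by
  -- The swap condition determines the dihedral part of the second type, leaving only its parity bit
  -- free.
  have h : (∑ q : Ty × Ty, if q.2.1 = q.1.1.swap ∧ Ty.combine t.1.2.2 q.1 q.2 = t then
      p.count q.1 * p.count q.2 else 0) = ∑ t₀ : Ty, ∑ o : Bool,
        if Ty.combine t.1.2.2 t₀ (t₀.1.swap, o) = t then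
          p.count t₀ * p.count (t₀.1.swap, o) else 0 := by
    rw [Fintype.sum_prod_type]
    refine Finset.sum_congr rfl fun t₀ _ => ?_
    rw [Fintype.sum_prod_type, Finset.sum_eq_single t₀.1.swap (by simp +contextual) (by simp)]
    simp
  rw [h]
  clear h
  obtain ⟨⟨_ | _, _ | _, _ | _⟩, _ | _⟩ := t <;>
    simp [Fintype.sum_prod_type, Profile.count, Profile.next, Dih.swap, Ty.combine, Ty.parity] <;>
    ring

theorem card_typeFinset_eq (n : ℕ) (t : Ty) :
    (typeFinset (n + 1) t).card = (profile n).count t := by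
  induction n generalizing t with
  | zero =>
    -- The base case is level 1: at level 0 the counts are not constant on the six classes.
    rw [card_typeFinset_succ]
    simp only [card_typeFinset_zero]
    revert t
    decide +kernel
  | succ n ih =>
    rw [card_typeFinset_succ]
    simp only [ih]
    exact (profile n).sum_next t

theorem growth_succ (n : ℕ) :
    portraitGrowth grigorchukGroup (n + 1) = (profile n).total := by
  rw [portraitGrowth_grigorchukGroup, ncard_boundedSet, ← Profile.sum_count]
  exact Finset.sum_congr rfl fun t _ => card_typeFinset_eq n t

theorem growth_zero : portraitGrowth grigorchukGroup 0 = 5 := by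
  rw [portraitGrowth_grigorchukGroup, ncard_boundedSet]
  simp only [card_typeFinset_zero]
  decide +kernel

/-! ### Quadratic bounds and explicit values -/

/-- The difference of the two sides is 4(x + y − u − v)². -/
theorem Profile.total_sq_le (p : Profile) : p.total ^ 2 ≤ 4 * p.next.total := by
  simp only [Profile.total, Profile.next]
  zify
  nlinarith [sq_nonneg ((p.x : ℤ) + p.y - p.u - p.v)]

theorem Profile.next_total_le (p : Profile) : p.next.total ≤ 2 * p.total ^ 2 := by
  have h : p.next.total = 2 * ((p.x + p.y) ^ 2 + (p.u + p.v) ^ 2 + 2 * (p.z + p.w) ^ 2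
      + 2 * (p.x + p.y) * (p.z + p.w) + 2 * (p.u + p.v) * (p.z + p.w)) := by
    simp only [Profile.total, Profile.next]
    ring
  rw [h, Profile.total]
  nlinarith [Nat.zero_le ((p.x + p.y) * (p.z + p.w)), Nat.zero_le ((p.u + p.v) * (p.z + p.w)),
    Nat.zero_le ((p.x + p.y) * (p.u + p.v)), sq_nonneg (p.x + p.y), sq_nonneg (p.u + p.v),
    sq_nonneg (p.z + p.w)]

/-- The portrait growth sequence. -/
noncomputable def growth (n : ℕ) : ℝ := portraitGrowth grigorchukGroup n

theorem growth_sq_le (n : ℕ) : growth n ^ 2 ≤ 4 * growth (n + 1) := by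
  simp only [growth]
  cases n with
  | zero => rw [growth_zero, growth_succ]; norm_num [profile, Profile.total]
  | succ n =>
    rw [growth_succ, growth_succ]
    exact_mod_cast (profile n).total_sq_le

theorem growth_succ_le (n : ℕ) : growth (n + 1) ≤ 2 * growth n ^ 2 := by
  simp only [growth]
  cases n with
  | zero => rw [growth_zero, growth_succ]; norm_num [profile, Profile.total]
  | succ n =>
    rw [growth_succ, growth_succ]
    exact_mod_cast (profile n).next_total_le

theorem growth_two : growth 2 = 68 := by
  rw [growth, growth_succ]
  norm_num [profile, Profile.total, Profile.next]

set_option exponentiation.threshold 400 in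
theorem growth_nine_lt : growth 9 < 2.718 ^ 366 / 2 := by
  -- Here 2.718 is a rational stand-in for e; clearing denominators leaves an inequality of natural
  -- numbers.
  have h : 2 * (profile 8).total * 1000 ^ 366 < 2718 ^ 366 := by
    decide +kernel
  rw [growth, growth_succ]
  have h2 : (2 * (profile 8).total * 1000 ^ 366 : ℝ) < 2718 ^ 366 := by exact_mod_cast h
  have h3 : (2.718 : ℝ) ^ 366 = 2718 ^ 366 / 1000 ^ 366 := by rw [← div_pow]; norm_num
  rw [h3, div_div, lt_div_iff₀ (by positivity)]
  linarith

theorem growth_pos (n : ℕ) : 0 < growth n := by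
  induction n with
  | zero => rw [growth, growth_zero]; norm_num
  | succ n ih => nlinarith [growth_sq_le n, pow_pos ih 2]

/-! ## The growth exponent -/

/-- Lower approximations of the growth exponent. -/
noncomputable def lowerExponent (n : ℕ) : ℝ := Real.log (growth n / 4) / 2 ^ n

/-- Upper approximations of the growth exponent. -/
noncomputable def upperExponent (n : ℕ) : ℝ := Real.log (2 * growth n) / 2 ^ n

/-- The factor 1/4 normalises a_n² ≤ 4 a_{n+1} to (a_n/4)² ≤ a_{n+1}/4. Likewise the factor 2 in
`upperExponent` absorbs the constant of the opposite inequality. -/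
theorem monotone_lowerExponent : Monotone lowerExponent := by
  refine monotone_nat_of_le_succ fun n => ?_
  have hp := growth_pos n
  rw [lowerExponent, lowerExponent, div_le_div_iff₀ (by positivity) (by positivity), pow_succ']
  have h : 2 * Real.log (growth n / 4) ≤ Real.log (growth (n + 1) / 4) := by
    have : Real.log ((growth n / 4) ^ 2) ≤ Real.log (growth (n + 1) / 4) :=
      Real.log_le_log (by positivity) (by linarith [growth_sq_le n])
    simpa using this
  nlinarith [pow_pos (two_pos (α := ℝ)) n]

theorem antitone_upperExponent : Antitone upperExponent := by
  refine antitone_nat_of_succ_le fun n => ?_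
  have hp := growth_pos n
  have hq := growth_pos (n + 1)
  rw [upperExponent, upperExponent, div_le_div_iff₀ (by positivity) (by positivity), pow_succ']
  have h : Real.log (2 * growth (n + 1)) ≤ 2 * Real.log (2 * growth n) := by
    have : Real.log (2 * growth (n + 1)) ≤ Real.log ((2 * growth n) ^ 2) :=
      Real.log_le_log (by positivity) (by linarith [growth_succ_le n])
    simpa using this
  nlinarith [pow_pos (two_pos (α := ℝ)) n]

theorem lowerExponent_le_upperExponent (m n : ℕ) : lowerExponent m ≤ upperExponent n := by
  refine (monotone_lowerExponent (le_max_left m n)).trans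
    (le_trans ?_ (antitone_upperExponent (le_max_right m n)))
  have hp := growth_pos (max m n)
  exact div_le_div_of_nonneg_right (Real.log_le_log (by positivity) (by linarith)) (by positivity)

/-- The growth exponent. -/
noncomputable def exponent : ℝ := ⨆ n, lowerExponent n

theorem lowerExponent_le_exponent (n : ℕ) : lowerExponent n ≤ exponent :=
  le_ciSup (f := lowerExponent)
    ⟨upperExponent 0, by rintro _ ⟨m, rfl⟩; exact lowerExponent_le_upperExponent m 0⟩ n

theorem exponent_le_upperExponent (n : ℕ) : exponent ≤ upperExponent n :=
  ciSup_le fun m => lowerExponent_le_upperExponent m n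

theorem lt_exponent : 0.705 < exponent := by
  refine lt_of_lt_of_le ?_ (lowerExponent_le_exponent 2)
  rw [lowerExponent, growth_two, lt_div_iff₀ (by norm_num), Real.lt_log_iff_exp_lt (by norm_num)]
  -- The claim e^2.82 < 68/4 = 17, with 2.82 = 0.705 · 2², raised to the 50th power to make the
  -- exponent an integer.
  have h1 : Real.exp 141 < 17 ^ 50 := by
    calc Real.exp 141 = Real.exp 1 ^ 141 := by rw [← Real.exp_nat_mul]; norm_num
      _ < 2.7182818286 ^ 141 :=
        pow_lt_pow_left₀ Real.exp_one_lt_d9 (Real.exp_pos _).le (by norm_num)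
      _ < 17 ^ 50 := by norm_num
  refine lt_of_pow_lt_pow_left₀ 50 (by norm_num) ?_
  rw [← Real.exp_nat_mul]
  norm_num at h1 ⊢
  exact h1

theorem exponent_lt : exponent < 0.715 := by
  -- Upper and lower approximations differ by log 8/2^n; at level 8 this gap is still too large,
  -- since γ exceeds 0.708. At level 9, 0.715 · 2⁹ = 366.08, whence the power 366.
  refine lt_of_le_of_lt (exponent_le_upperExponent 9) ?_
  have hp := growth_pos 9
  rw [upperExponent, div_lt_iff₀ (by norm_num), Real.log_lt_iff_lt_exp (by positivity)]
  calc 2 * growth 9 < (2.718 : ℝ) ^ 366 := (lt_div_iff₀' two_pos).1 growth_nine_lt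
    _ ≤ Real.exp 1 ^ 366 :=
      pow_le_pow_left₀ (by norm_num) (by linarith [Real.exp_one_gt_d9]) _
    _ = Real.exp 366 := by rw [← Real.exp_nat_mul]; norm_num
    _ ≤ Real.exp (0.715 * 2 ^ 9) := Real.exp_le_exp.2 (by norm_num)

theorem growth_le (n : ℕ) : growth n ≤ 4 * Real.exp (exponent * 2 ^ n) := by
  have h := lowerExponent_le_exponent n
  have hp := growth_pos n
  rw [lowerExponent, div_le_iff₀ (by positivity), Real.log_le_iff_le_exp (by positivity)] at h
  linarith

theorem le_growth (n : ℕ) : 1 / 2 * Real.exp (exponent * 2 ^ n) ≤ growth n := by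
  have h := exponent_le_upperExponent n
  have hp := growth_pos n
  rw [upperExponent, le_div_iff₀ (by positivity), Real.le_log_iff_exp_le (by positivity)] at h
  linarith

end PortraitGrowth

theorem mainTheorem2 :
    ∃ γ : ℝ, 0 < γ ∧ |γ - 0.71| < 0.005 ∧
      ∀ n : ℕ,
        (1 / 4 : ℝ) * Real.exp (γ * 2 ^ n) ≤
            (PortraitGrowth.portraitGrowth PortraitGrowth.grigorchukGroup n : ℝ) ∧
          (PortraitGrowth.portraitGrowth PortraitGrowth.grigorchukGroup n : ℝ) ≤
            4 * Real.exp (γ * 2 ^ n) := by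
  refine ⟨PortraitGrowth.exponent, ?_, ?_, fun n => ⟨?_, PortraitGrowth.growth_le n⟩⟩
  · linarith [PortraitGrowth.lt_exponent]
  · rw [abs_lt]
    constructor <;> linarith [PortraitGrowth.lt_exponent, PortraitGrowth.exponent_lt]
  -- The constant 1/2 obtained is better than the required 1/4.
  · refine le_trans ?_ (PortraitGrowth.le_growth n)
    have := Real.exp_pos (PortraitGrowth.exponent * 2 ^ n)
    linarith
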